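/- Let $N\ge 3$ be an integer. For $\beta\in\mathbb{R}$ let $u_\beta=u_\beta(r)$, $r=|x|$, denote the (unique) classical radial solution of $$\Delta^2 u_\beta=e^{u_\beta},\qquad u_\beta(0)=0,\quad \Delta u_\beta(0)=\beta,\quad u_\beta'(0)=(\Delta u_\beta)'(0)=0,$$ in $\mathbb{R}^N$, on its maximal interval of existence $[0,R(\beta))$, where $\Delta f(r)=f''(r)+\frac{N-1}{r}f'(r)$ for $r>0$ and $\Delta f(0)=Nf''(0)$. Let $\beta_0$ be the supremum of all $\beta$ with $R(\beta)=\infty$. Then $\beta_0$ is a real number, $R(\beta)=\infty$ if and only if $\beta\le\beta_0$, and for every $\beta\le\beta_0$ the limit $\lim_{r\to\infty}\Delta u_\beta(r)$ exists, is finite and satisfies $$\lim_{r\to\infty}\Delta u_\beta(r)\le 0;$$ moreover, this limit equals $0$ if and only if $\beta=\beta_0$. -/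

import Mathlib

open Filter Topology

/-- The Laplacian in `ℝ^N` of the radial function `x ↦ f (‖x‖)`, read on its profile `f`:
`f'' + ((N - 1) / r) f' = r ^ (1 - N) (r ^ (N - 1) f')'` away from the origin, and `N f''(0)` at the
origin. -/
noncomputable def radialLaplacian (N : ℕ) (f : ℝ → ℝ) (r : ℝ) : ℝ :=
  if r = 0 then N * deriv (deriv f) 0
  else deriv (deriv f) r + ((N : ℝ) - 1) / r * deriv f r

/-- `u` is the profile of an entire classical radial solution of `Δ² u = e ^ u` in `ℝ^N` with
`u(0) = 0`, `Δu(0) = β` and `u'(0) = (Δu)'(0) = 0`.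

The profile is the restriction of the radial function to a line through the origin, so it is an
even function on `ℝ`; the radial function is `C⁴` on `ℝ^N` exactly when this even function is `C⁴`
on `ℝ`. -/
structure IsEntireRadialSolution (N : ℕ) (β : ℝ) (u : ℝ → ℝ) : Prop where
  even : ∀ r, u (-r) = u r
  contDiff : ContDiff ℝ 4 u
  equation : ∀ r, 0 ≤ r → radialLaplacian N (radialLaplacian N u) r = Real.exp (u r)
  value_zero : u 0 = 0
  laplacian_zero : radialLaplacian N u 0 = β
  deriv_zero : deriv u 0 = 0
  deriv_laplacian_zero : deriv (radialLaplacian N u) 0 = 0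

/-- The threshold `β₀` (in dimension `N`): the supremum of the `β` for which the radial solution
`u_β` exists on all of `[0, ∞)`. -/
noncomputable def betaZero (N : ℕ) : ℝ :=
  sSup {β : ℝ | ∃ u : ℝ → ℝ, IsEntireRadialSolution N β u}

/-!
Writing `P` for the operator inverting the radial Laplacian with zero initial data, an entire
solution is a fixed point of `u ↦ P (β + P (e ^ u))`, and its Laplacian is `v = β + P (e ^ u)`,
which increases in `r`. If `v` became positive, `u` would grow until `e ^ u` blows up; hence
`v ≤ 0`, and `v` has a limit `σ ≤ 0`. Comparison shows that `u` and `v` increase with `β`, the gap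
of two Laplacians being at least the gap of the initial values, so `σ < 0` below the threshold.
Since `P` is monotone, iterating from a supersolution gives a solution: solutions persist when `β`
decreases, and monotone limits reach the threshold. Finally, if `σ < 0` then `u ≤ σ r² / (2N)`,
and for `N ≥ 3` the Gaussian decay of `e ^ u` makes the potential that governs the linearized
equation bounded. This leaves room for a supersolution with a larger `β`, so `σ = 0` at the
threshold.
-/

/-! ### Radial means and potentials -/

/-- The weighted radial mean `∫₀¹ tᵏ f(rt) dt`. For `k = N - 1` it is `1 / N` times the average over
the ball of radius `r` in `ℝ^N` of the radial function with profile `f`; the rescaled variable makes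
the formula regular at `r = 0`. -/
noncomputable def radialMean (k : ℕ) (f : ℝ → ℝ) (r : ℝ) : ℝ :=
  ∫ t in (0 : ℝ)..1, t ^ k * f (r * t)

/-- The radial Newtonian potential: the profile `w` with `Δ w = f` in `ℝ^N` and
`w(0) = w'(0) = 0`, that is `∫₀ʳ s (∫₀¹ t ^ (N - 1) f(st) dt) ds`. It is only meaningful for
`0 < N`. -/
noncomputable def radialPotential (N : ℕ) (f : ℝ → ℝ) (r : ℝ) : ℝ :=
  r ^ 2 * radialMean 1 (radialMean (N - 1) f) r

section Basic

variable {N k : ℕ} {f g : ℝ → ℝ} {r : ℝ}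

@[fun_prop]
theorem continuous_radialMean (hf : Continuous f) : Continuous (radialMean k f) :=
  intervalIntegral.continuous_parametric_intervalIntegral_of_continuous' (by fun_prop) _ _

@[fun_prop]
theorem continuous_radialPotential (hf : Continuous f) : Continuous (radialPotential N f) := by
  unfold radialPotential
  fun_prop

theorem even_radialMean (hf : Function.Even f) : Function.Even (radialMean k f) := fun r => by
  simp only [radialMean, neg_mul, hf _]

theorem even_radialPotential (hf : Function.Even f) : Function.Even (radialPotential N f) :=
  fun r => by simp only [radialPotential, even_radialMean (even_radialMean hf) r, neg_sq]

theorem apply_abs_of_even (hf : Function.Even f) (r : ℝ) : f |r| = f r := by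
  rcases abs_choice r with h | h <;> simp only [h, hf r]

theorem radialMean_const (k : ℕ) (c r : ℝ) : radialMean k (fun _ => c) r = c / (k + 1) := by
  simp [radialMean, div_eq_inv_mul]

theorem radialMean_apply_zero (k : ℕ) (f : ℝ → ℝ) : radialMean k f 0 = f 0 / (k + 1) := by
  simpa [radialMean] using radialMean_const k (f 0) 0

theorem radialPotential_apply_zero (N : ℕ) (f : ℝ → ℝ) : radialPotential N f 0 = 0 := by
  simp [radialPotential]

theorem radialPotential_const (hN : 0 < N) (c r : ℝ) :
    radialPotential N (fun _ => c) r = c * r ^ 2 / (2 * N) := by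
  have hmean : radialMean (N - 1) (fun _ => c) = fun _ => c / N := by
    funext s
    rw [radialMean_const, Nat.cast_pred hN, sub_add_cancel]
  rw [radialPotential, hmean, radialMean_const]
  have : (N : ℝ) ≠ 0 := by positivity
  field_simp
  norm_num

theorem radialMean_add (hf : Continuous f) (hg : Continuous g) (r : ℝ) :
    radialMean k (fun s => f s + g s) r = radialMean k f r + radialMean k g r := by
  simp only [radialMean, mul_add]
  exact intervalIntegral.integral_add (Continuous.intervalIntegrable (by fun_prop) _ _)
    (Continuous.intervalIntegrable (by fun_prop) _ _)

theorem radialPotential_add (hf : Continuous f) (hg : Continuous g) (r : ℝ) :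
    radialPotential N (fun s => f s + g s) r = radialPotential N f r + radialPotential N g r := by
  simp only [radialPotential, funext (radialMean_add hf hg)]
  rw [radialMean_add (by fun_prop) (by fun_prop), mul_add]

theorem radialMean_mul_const (k : ℕ) (f : ℝ → ℝ) (c r : ℝ) :
    radialMean k (fun s => f s * c) r = radialMean k f r * c := by
  simp only [radialMean, ← mul_assoc, intervalIntegral.integral_mul_const]

theorem radialPotential_mul_const (N : ℕ) (f : ℝ → ℝ) (c r : ℝ) :
    radialPotential N (fun s => f s * c) r = radialPotential N f r * c := by
  simp only [radialPotential, funext (radialMean_mul_const (N - 1) f c)]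
  rw [radialMean_mul_const, mul_assoc]

theorem mul_mem_uIcc_zero (r : ℝ) {t : ℝ} (ht : t ∈ Set.Icc (0 : ℝ) 1) :
    r * t ∈ Set.uIcc 0 r := by
  rcases le_total 0 r with hr | hr
  · rw [Set.uIcc_of_le hr]
    exact ⟨mul_nonneg hr ht.1, mul_le_of_le_one_right hr ht.2⟩
  · rw [Set.uIcc_of_ge hr]
    exact ⟨by nlinarith [ht.2], mul_nonpos_of_nonpos_of_nonneg hr ht.1⟩

theorem radialMean_mono (hf : Continuous f) (hg : Continuous g)
    (h : ∀ s ∈ Set.uIcc 0 r, f s ≤ g s) : radialMean k f r ≤ radialMean k g r :=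
  intervalIntegral.integral_mono_on zero_le_one (Continuous.intervalIntegrable (by fun_prop) _ _)
    (Continuous.intervalIntegrable (by fun_prop) _ _) fun _ ht =>
      mul_le_mul_of_nonneg_left (h _ (mul_mem_uIcc_zero r ht)) (pow_nonneg ht.1 _)

theorem radialPotential_mono (hf : Continuous f) (hg : Continuous g)
    (h : ∀ s ∈ Set.uIcc 0 r, f s ≤ g s) : radialPotential N f r ≤ radialPotential N g r :=
  mul_le_mul_of_nonneg_left
    (radialMean_mono (by fun_prop) (by fun_prop) fun _ hs =>
      radialMean_mono hf hg fun x hx => h x (Set.uIcc_subset_uIcc_left hs hx))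
    (sq_nonneg r)

theorem radialMean_nonneg (hf : Continuous f) (h : ∀ s ∈ Set.uIcc 0 r, 0 ≤ f s) :
    0 ≤ radialMean k f r := by
  simpa [radialMean_const] using radialMean_mono (k := k) (continuous_const (y := (0 : ℝ))) hf h

theorem radialPotential_nonneg (hf : Continuous f) (h : ∀ s ∈ Set.uIcc 0 r, 0 ≤ f s) :
    0 ≤ radialPotential N f r :=
  mul_nonneg (sq_nonneg r) <| radialMean_nonneg (by fun_prop) fun _ hs =>
    radialMean_nonneg hf fun x hx => h x (Set.uIcc_subset_uIcc_left hs hx)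

theorem abs_radialMean_le (hf : Continuous f) (hg : Continuous g) (h : ∀ s, |f s| ≤ g s) (r : ℝ) :
    |radialMean k f r| ≤ radialMean k g r := by
  have hneg : -radialMean k g r = radialMean k (fun s => g s * -1) r := by
    rw [radialMean_mul_const, mul_neg_one]
  refine abs_le.2 ⟨hneg ▸ radialMean_mono (by fun_prop) hf fun s _ => ?_,
    radialMean_mono hf hg fun s _ => (abs_le.1 (h s)).2⟩
  rw [mul_neg_one]
  exact (abs_le.1 (h s)).1

end Basic

/-! ### Derivatives of radial means and potentials -/

section Deriv

variable {N k : ℕ} {f : ℝ → ℝ}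

theorem pow_mul_radialMean (k : ℕ) (f : ℝ → ℝ) (r : ℝ) :
    r ^ (k + 1) * radialMean k f r = ∫ t in (0 : ℝ)..r, t ^ k * f t := by
  have hsubst := intervalIntegral.smul_integral_comp_mul_left (a := 0) (b := 1)
    (fun t => t ^ k * f t) r
  simp only [mul_zero, mul_one, smul_eq_mul] at hsubst
  rw [← hsubst, radialMean, pow_succ', mul_assoc, ← intervalIntegral.integral_const_mul]
  simp only [mul_pow, mul_assoc]

theorem hasDerivAt_integral_zero (hf : Continuous f) (r : ℝ) :
    HasDerivAt (fun s => ∫ t in (0 : ℝ)..s, f t) (f r) r :=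
  intervalIntegral.integral_hasDerivAt_right (hf.intervalIntegrable _ _)
    hf.stronglyMeasurable.stronglyMeasurableAtFilter hf.continuousAt

theorem hasDerivAt_pow_mul_radialMean (k : ℕ) (hf : Continuous f) (r : ℝ) :
    HasDerivAt (fun s => s ^ (k + 1) * radialMean k f s) (r ^ k * f r) r := by
  simp only [pow_mul_radialMean]
  exact hasDerivAt_integral_zero (f := fun t => t ^ k * f t) (by fun_prop) r

theorem hasDerivAt_mul_radialMean (k : ℕ) (hf : Continuous f) (r : ℝ) :
    HasDerivAt (fun s => s * radialMean k f s) (f r - k * radialMean k f r) r := by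
  -- The quotient rule gives the formula away from the origin, continuity extends it to the origin.
  refine hasDerivAt_of_hasDerivAt_of_ne' (x := 0) (g := fun s => f s - k * radialMean k f s)
    (fun s hs => ?_) (Continuous.continuousAt (by fun_prop))
    (Continuous.continuousAt (by fun_prop)) r
  refine (((hasDerivAt_pow_mul_radialMean k hf s).div (hasDerivAt_pow k s)
    (pow_ne_zero k hs)).congr_deriv ?_).congr_of_eventuallyEq ?_
  · cases k with
    | zero => simp
    | succ k =>
      simp only [Nat.add_sub_cancel]
      field_simp
      ring
  · filter_upwards [eventually_ne_nhds hs] with x hx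
    rw [Pi.div_apply]
    field_simp
    ring

theorem mul_radialMean_deriv (k : ℕ) (hf : ContDiff ℝ 1 f) (r : ℝ) :
    r * radialMean (k + 1) (deriv f) r = f r - (k + 1) * radialMean k f r := by
  have : Continuous (deriv f) := hf.continuous_deriv le_rfl
  have hparts := intervalIntegral.integral_mul_deriv_eq_deriv_mul (a := 0) (b := 1)
    (u := fun t => t ^ (k + 1)) (v := fun t => f (r * t)) (u' := fun t => (k + 1 : ℕ) * t ^ k)
    (v' := fun t => deriv f (r * t) * r)
    (fun t _ => by simpa using hasDerivAt_pow (k + 1) t)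
    (fun t _ => (hf.differentiable one_ne_zero (r * t)).hasDerivAt.comp t
      (by simpa using (hasDerivAt_id t).const_mul r))
    (Continuous.intervalIntegrable (by fun_prop) _ _)
    (Continuous.intervalIntegrable (by fun_prop) _ _)
  simp only [← mul_assoc, intervalIntegral.integral_mul_const] at hparts
  simp only [mul_assoc, intervalIntegral.integral_const_mul] at hparts
  simpa [radialMean, mul_comm r] using hparts

theorem hasDerivAt_radialMean (k : ℕ) (hf : ContDiff ℝ 1 f) (r : ℝ) :
    HasDerivAt (radialMean k f) (radialMean (k + 1) (deriv f) r) r := by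
  have hf0 : Continuous f := hf.continuous
  have : Continuous (deriv f) := hf.continuous_deriv le_rfl
  refine hasDerivAt_of_hasDerivAt_of_ne' (x := 0) (fun s hs => ?_)
    (Continuous.continuousAt (by fun_prop)) (Continuous.continuousAt (by fun_prop)) r
  refine (((hasDerivAt_mul_radialMean k hf0 s).div (hasDerivAt_id s) hs).congr_deriv
    ?_).congr_of_eventuallyEq ?_
  · have := mul_radialMean_deriv k hf s
    simp only [id]
    field_simp
    linarith
  · filter_upwards [eventually_ne_nhds hs] with x hx
    rw [Pi.div_apply, id, mul_div_cancel_left₀ _ hx]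

theorem contDiff_radialMean (n k : ℕ) (hf : ContDiff ℝ n f) : ContDiff ℝ n (radialMean k f) := by
  induction n generalizing k f with
  | zero => exact contDiff_zero.2 (continuous_radialMean hf.continuous)
  | succ n ih =>
    have hderiv := hasDerivAt_radialMean k (hf.of_le (by exact_mod_cast Nat.le_add_left 1 n))
    rw [Nat.cast_add, Nat.cast_one, contDiff_succ_iff_deriv] at hf ⊢
    refine ⟨fun r => (hderiv r).differentiableAt, by simp, ?_⟩
    rw [deriv_eq hderiv]
    exact ih _ hf.2.2

theorem hasDerivAt_radialPotential (hf : Continuous f) (r : ℝ) :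
    HasDerivAt (radialPotential N f) (r * radialMean (N - 1) f r) r := by
  simpa [← radialPotential.eq_def] using
    hasDerivAt_pow_mul_radialMean 1 (continuous_radialMean (k := N - 1) hf) r

theorem deriv_radialPotential (N : ℕ) (hf : Continuous f) :
    deriv (radialPotential N f) = fun r => r * radialMean (N - 1) f r :=
  deriv_eq (hasDerivAt_radialPotential hf)

theorem contDiff_radialPotential (n : ℕ) (hf : ContDiff ℝ n f) :
    ContDiff ℝ (n + 2) (radialPotential N f) := by
  have hf0 := hf.continuous
  have hmean := contDiff_radialMean n (N - 1) hf
  have hderiv := hasDerivAt_mul_radialMean (N - 1) hf0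
  rw [← one_add_one_eq_two, ← add_assoc, contDiff_succ_iff_deriv, deriv_radialPotential N hf0,
    contDiff_succ_iff_deriv, deriv_eq hderiv]
  exact ⟨fun r => (hasDerivAt_radialPotential hf0 r).differentiableAt, by simp,
    fun r => (hderiv r).differentiableAt, by simp, by fun_prop⟩

theorem radialLaplacian_radialPotential (hN : 0 < N) (hf : Continuous f) :
    radialLaplacian N (radialPotential N f) = f := by
  have hN0 : (N : ℝ) ≠ 0 := by positivity
  funext r
  rw [radialLaplacian, deriv_radialPotential N hf, deriv_eq (hasDerivAt_mul_radialMean (N - 1) hf),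
    Nat.cast_pred hN]
  split_ifs with hr
  · subst hr
    simp only [radialMean_apply_zero, Nat.cast_pred hN, sub_add_cancel]
    field_simp
    ring
  · field_simp
    ring

/-- Integration by parts in `∫₀ʳ s f(s) ds`. -/
theorem radialPotential_add_sq_mul_radialMean (hN : 0 < N) (hf : Continuous f) (r : ℝ) :
    (N - 2) * radialPotential N f r + r ^ 2 * radialMean (N - 1) f r =
      ∫ s in (0 : ℝ)..r, s * f s := by
  have hderiv : ∀ s, HasDerivAt (fun s => (N - 2) * radialPotential N f s +
      s * (s * radialMean (N - 1) f s)) (s * f s) s := fun s => by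
    refine (((hasDerivAt_radialPotential hf s).const_mul ((N : ℝ) - 2)).add
      ((hasDerivAt_id s).mul (hasDerivAt_mul_radialMean (N - 1) hf s))).congr_deriv ?_
    rw [Nat.cast_pred hN, id]
    ring
  rw [intervalIntegral.integral_eq_sub_of_hasDerivAt (fun s _ => hderiv s)
    (Continuous.intervalIntegrable (by fun_prop) _ _), radialPotential_apply_zero]
  ring

end Deriv

/-! ### The integral equation -/

section Laplacian

variable {N : ℕ} {f : ℝ → ℝ}

theorem radialLaplacian_const_add (N : ℕ) (c : ℝ) (f : ℝ → ℝ) :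
    radialLaplacian N (fun r => c + f r) = radialLaplacian N f := by
  have : deriv (fun r => c + f r) = deriv f := funext fun _ => deriv_const_add c
  funext r
  simp only [radialLaplacian, this]

theorem even_radialLaplacian (hf : Function.Even f) : Function.Even (radialLaplacian N f) := by
  have hf' : Function.Odd (deriv f) := fun r => by
    rw [← neg_inj, neg_neg, ← deriv_comp_neg, funext hf]
  have hf'' : Function.Even (deriv (deriv f)) := fun r => by
    rw [← neg_inj, ← deriv_comp_neg, funext hf', deriv.fun_neg]
  intro r
  simp only [radialLaplacian, neg_eq_zero, hf' r, hf'' r, div_neg, neg_mul_neg]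

theorem mul_radialMean_zero_deriv (hf : ContDiff ℝ 1 f) (h0 : f 0 = 0) (r : ℝ) :
    r * radialMean 0 (deriv f) r = f r := by
  have hftc := pow_mul_radialMean 0 (deriv f) r
  simp only [zero_add, pow_one, pow_zero, one_mul] at hftc
  rw [hftc, intervalIntegral.integral_deriv_eq_sub (fun s _ => hf.differentiable one_ne_zero s)
    ((hf.continuous_deriv le_rfl).intervalIntegrable _ _), h0, sub_zero]

theorem radialLaplacian_eq_add_radialMean (N : ℕ) (hf : ContDiff ℝ 2 f) (h0 : deriv f 0 = 0) :
    radialLaplacian N f =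
      fun r => deriv (deriv f) r + ((N : ℝ) - 1) * radialMean 0 (deriv (deriv f)) r := by
  funext r
  rw [radialLaplacian]
  split_ifs with hr
  · rw [hr, radialMean_apply_zero]
    push_cast
    ring
  · have hf' : ContDiff ℝ 1 (deriv f) := ContDiff.deriv' (by rwa [one_add_one_eq_two])
    rw [← mul_radialMean_zero_deriv hf' h0 r]
    field_simp

theorem contDiff_radialLaplacian (N n : ℕ) (hf : ContDiff ℝ (n + 2) f) (h0 : deriv f 0 = 0) :
    ContDiff ℝ n (radialLaplacian N f) := by
  have hf'' : ContDiff ℝ n (deriv (deriv f)) :=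
    ContDiff.deriv' (ContDiff.deriv' (by rwa [add_assoc, one_add_one_eq_two]))
  have hmean := contDiff_radialMean n 0 hf''
  rw [radialLaplacian_eq_add_radialMean N (hf.of_le le_add_self) h0]
  fun_prop

/-- The divergence theorem on balls. -/
theorem mul_radialMean_radialLaplacian (hN : 0 < N) (hf : ContDiff ℝ 2 f) (h0 : deriv f 0 = 0)
    (r : ℝ) : r * radialMean (N - 1) (radialLaplacian N f) r = deriv f r := by
  obtain ⟨k, rfl⟩ := Nat.exists_eq_add_one_of_ne_zero hN.ne'
  have hf' : ContDiff ℝ 1 (deriv f) := ContDiff.deriv' (by rwa [one_add_one_eq_two])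
  have hLf : Continuous (radialLaplacian (k + 1) f) :=
    (contDiff_radialLaplacian _ 0 (by simpa) h0).continuous
  have hderiv : ∀ s, HasDerivAt (fun s => s ^ k * deriv f s)
      (s ^ k * radialLaplacian (k + 1) f s) s := fun s => by
    refine ((hasDerivAt_pow k s).mul
      (hf'.differentiable one_ne_zero s).hasDerivAt).congr_deriv ?_
    rw [radialLaplacian_eq_add_radialMean _ hf h0, ← mul_radialMean_zero_deriv hf' h0 s]
    cases k <;> push_cast [Nat.add_sub_cancel] <;> ring
  have hftc : r ^ (k + 1) * radialMean k (radialLaplacian (k + 1) f) r = r ^ k * deriv f r := by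
    rw [pow_mul_radialMean, intervalIntegral.integral_eq_sub_of_hasDerivAt (fun s _ => hderiv s)
      (Continuous.intervalIntegrable (by fun_prop) _ _), h0, mul_zero, sub_zero]
  rcases eq_or_ne r 0 with rfl | hr
  · rw [h0, zero_mul]
  · rwa [pow_succ, mul_assoc, mul_right_inj' (pow_ne_zero k hr)] at hftc

theorem radialPotential_radialLaplacian (hN : 0 < N) (hf : ContDiff ℝ 2 f) (h0 : deriv f 0 = 0)
    (r : ℝ) : radialPotential N (radialLaplacian N f) r = f r - f 0 := by
  have hLf : Continuous (radialLaplacian N f) :=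
    (contDiff_radialLaplacian N 0 (by simpa) h0).continuous
  have hderiv : ∀ s, HasDerivAt (fun s => radialPotential N (radialLaplacian N f) s - f s) 0 s :=
    fun s => by
      refine ((hasDerivAt_radialPotential hLf s).sub
        (hf.differentiable two_ne_zero s).hasDerivAt).congr_deriv ?_
      rw [mul_radialMean_radialLaplacian hN hf h0, sub_self]
  have hconst := is_const_of_deriv_eq_zero (fun s => (hderiv s).differentiableAt)
    (fun s => (hderiv s).deriv) r 0
  rw [radialPotential_apply_zero] at hconst
  linarith

end Laplacian

/-- The Laplacian of a solution `u` of the initial value problem with `Δu(0) = β`, expressed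
through `u` by the integral form of `Δ(Δu) = e ^ u`. -/
noncomputable def integralLaplacian (N : ℕ) (β : ℝ) (u : ℝ → ℝ) (r : ℝ) : ℝ :=
  β + radialPotential N (fun s => Real.exp (u s)) r

/-- The Picard operator of the initial value problem, whose fixed points are the entire
solutions. -/
noncomputable def picardMap (N : ℕ) (β : ℝ) (u : ℝ → ℝ) : ℝ → ℝ :=
  radialPotential N (integralLaplacian N β u)

/-- An entire solution of the integral form of the initial value problem; as in
`IsEntireRadialSolution`, profiles are even functions on the whole line. -/
structure IsIntegralSolution (N : ℕ) (β : ℝ) (u : ℝ → ℝ) : Prop where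
  even : Function.Even u
  continuous : Continuous u
  isFixedPt : Function.IsFixedPt (picardMap N β) u

section Equivalence

variable {N : ℕ} {β : ℝ} {u : ℝ → ℝ}

@[fun_prop]
theorem continuous_integralLaplacian (hu : Continuous u) :
    Continuous (integralLaplacian N β u) := by
  unfold integralLaplacian
  fun_prop

@[fun_prop]
theorem continuous_picardMap (hu : Continuous u) : Continuous (picardMap N β u) :=
  continuous_radialPotential (continuous_integralLaplacian hu)

theorem even_integralLaplacian (hu : Function.Even u) :
    Function.Even (integralLaplacian N β u) :=
  (Function.Even.const β).add (even_radialPotential (hu.left_comp Real.exp))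

theorem even_picardMap (hu : Function.Even u) : Function.Even (picardMap N β u) :=
  even_radialPotential (even_integralLaplacian hu)

theorem integralLaplacian_apply_zero (N : ℕ) (β : ℝ) (u : ℝ → ℝ) :
    integralLaplacian N β u 0 = β := by
  rw [integralLaplacian, radialPotential_apply_zero, add_zero]

theorem IsIntegralSolution.isEntireRadialSolution (hN : 0 < N) (h : IsIntegralSolution N β u) :
    IsEntireRadialSolution N β u := by
  have hexp : Continuous fun s => Real.exp (u s) := h.continuous.rexp
  have hv : Continuous (integralLaplacian N β u) := continuous_integralLaplacian h.continuous
  have hu : radialPotential N (integralLaplacian N β u) = u := h.isFixedPt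
  have hΔu : radialLaplacian N u = integralLaplacian N β u := by
    conv_lhs => rw [← hu]
    exact radialLaplacian_radialPotential hN hv
  have hΔv : radialLaplacian N (integralLaplacian N β u) = fun s => Real.exp (u s) :=
    (radialLaplacian_const_add N β _).trans (radialLaplacian_radialPotential hN hexp)
  have hv2 : ContDiff ℝ 2 (integralLaplacian N β u) :=
    contDiff_const.add (by simpa using contDiff_radialPotential 0 (contDiff_zero.2 hexp))
  refine ⟨h.even, ?_, fun r _ => by rw [hΔu, hΔv], ?_, ?_, ?_, ?_⟩
  · rw [← hu]
    exact (contDiff_radialPotential 2 hv2).of_le (by norm_num)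
  · rw [← hu, radialPotential_apply_zero]
  · rw [hΔu, integralLaplacian_apply_zero]
  · rw [← hu, (hasDerivAt_radialPotential hv 0).deriv, zero_mul]
  · rw [hΔu]
    exact ((hasDerivAt_radialPotential hexp 0).const_add β).deriv.trans (zero_mul _)

theorem IsEntireRadialSolution.radialLaplacian_eq (hN : 0 < N) (h : IsEntireRadialSolution N β u) :
    radialLaplacian N u = integralLaplacian N β u := by
  have hv : ContDiff ℝ 2 (radialLaplacian N u) :=
    contDiff_radialLaplacian N 2 (h.contDiff.of_le (by norm_num)) h.deriv_zero
  have heq : radialLaplacian N (radialLaplacian N u) = fun s => Real.exp (u s) := by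
    funext r
    rw [← apply_abs_of_even (even_radialLaplacian (even_radialLaplacian h.even)) r,
      h.equation _ (abs_nonneg r), apply_abs_of_even h.even]
  funext r
  rw [integralLaplacian, ← heq, radialPotential_radialLaplacian hN hv h.deriv_laplacian_zero,
    h.laplacian_zero, add_sub_cancel]

theorem IsEntireRadialSolution.isIntegralSolution (hN : 0 < N) (h : IsEntireRadialSolution N β u) :
    IsIntegralSolution N β u := by
  refine ⟨h.even, h.contDiff.continuous, funext fun r => ?_⟩
  rw [picardMap, ← h.radialLaplacian_eq hN, radialPotential_radialLaplacian hN
    (h.contDiff.of_le (by norm_num)) h.deriv_zero, h.value_zero, sub_zero]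

theorem isEntireRadialSolution_iff (hN : 0 < N) :
    IsEntireRadialSolution N β u ↔ IsIntegralSolution N β u :=
  ⟨fun h => h.isIntegralSolution hN, fun h => h.isEntireRadialSolution hN⟩

end Equivalence

/-! ### Growth and blow-up -/

section Growth

variable {N k : ℕ} {f : ℝ → ℝ} {ρ K s : ℝ}

theorem le_of_hasDerivAt_le {f g f' g' : ℝ → ℝ} {a s : ℝ} (hf : ∀ x, HasDerivAt f (f' x) x)
    (hg : ∀ x, HasDerivAt g (g' x) x) (h : ∀ x, a ≤ x → f' x ≤ g' x) (ha : f a ≤ g a)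
    (hs : a ≤ s) : f s ≤ g s :=
  image_le_of_deriv_right_le_deriv_boundary (a := a) (b := s)
    (fun x _ => (hf x).continuousAt.continuousWithinAt) (fun x _ => (hf x).hasDerivWithinAt) ha
    (fun x _ => (hg x).continuousAt.continuousWithinAt) (fun x _ => (hg x).hasDerivWithinAt)
    (fun x hx => h x hx.1) (Set.right_mem_Icc.2 hs)

theorem pow_mul_radialMean_ge (hf : Continuous f) (hρ : 0 ≤ ρ) (hfK : ∀ x, ρ ≤ x → K ≤ f x)
    (hs : ρ ≤ s) :
    ρ ^ (k + 1) * radialMean k f ρ + K * (s ^ (k + 1) - ρ ^ (k + 1)) / (k + 1) ≤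
      s ^ (k + 1) * radialMean k f s := by
  refine le_of_hasDerivAt_le
    (f := fun s => ρ ^ (k + 1) * radialMean k f ρ + K * (s ^ (k + 1) - ρ ^ (k + 1)) / (k + 1))
    (f' := fun s => s ^ k * K) (fun x => ?_) (hasDerivAt_pow_mul_radialMean k hf)
    (fun x hx => mul_le_mul_of_nonneg_left (hfK x hx) (pow_nonneg (hρ.trans hx) _)) (by simp) hs
  refine (((((hasDerivAt_pow (k + 1) x).sub_const _).const_mul K).div_const _).const_add
    _).congr_deriv ?_
  push_cast [Nat.add_sub_cancel]
  field_simp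

theorem mul_radialMean_ge (hN : 0 < N) (hf : Continuous f) (hρ : 0 ≤ ρ) (hK : 0 ≤ K)
    (hfK : ∀ x, ρ ≤ x → K ≤ f x) (hmean : 0 ≤ radialMean (N - 1) f ρ) (hs : ρ ≤ s) :
    K * (s - ρ) / N ≤ s * radialMean (N - 1) f s := by
  obtain ⟨k, rfl⟩ := Nat.exists_eq_add_one_of_ne_zero hN.ne'
  rw [Nat.add_sub_cancel] at *
  rcases (hρ.trans hs).eq_or_lt with rfl | hs0
  · simp [le_antisymm hs hρ]
  have hpow : s ^ k * (s - ρ) ≤ s ^ (k + 1) - ρ ^ (k + 1) := by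
    have : ρ ^ k * ρ ≤ s ^ k * ρ := by gcongr
    rw [pow_succ, pow_succ]
    linarith
  refine le_of_mul_le_mul_left ?_ (pow_pos hs0 k)
  calc s ^ k * (K * (s - ρ) / (k + 1 : ℕ)) = K * (s ^ k * (s - ρ)) / (k + 1) := by
        push_cast
        ring
    _ ≤ K * (s ^ (k + 1) - ρ ^ (k + 1)) / (k + 1) := by gcongr
    _ ≤ ρ ^ (k + 1) * radialMean k f ρ + K * (s ^ (k + 1) - ρ ^ (k + 1)) / (k + 1) :=
        le_add_of_nonneg_left (mul_nonneg (pow_nonneg hρ _) hmean)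
    _ ≤ s ^ (k + 1) * radialMean k f s := pow_mul_radialMean_ge hf hρ hfK hs
    _ = s ^ k * (s * radialMean k f s) := by ring

theorem radialMean_nonneg_of_le (hf : Continuous f) (hρ : 0 ≤ ρ) (hf0 : ∀ x, ρ ≤ x → 0 ≤ f x)
    (hmean : 0 ≤ radialMean k f ρ) (hs : ρ ≤ s) : 0 ≤ radialMean k f s := by
  rcases (hρ.trans hs).eq_or_lt with rfl | hs0
  · rwa [le_antisymm hs hρ] at hmean
  have hge := pow_mul_radialMean_ge (k := k) hf hρ hf0 hs
  rw [zero_mul, zero_div, add_zero] at hge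
  exact nonneg_of_mul_nonneg_right ((mul_nonneg (pow_nonneg hρ _) hmean).trans hge)
    (pow_pos hs0 _)

theorem radialPotential_ge (hN : 0 < N) (hf : Continuous f) (hρ : 0 ≤ ρ) (hK : 0 ≤ K)
    (hfK : ∀ x, ρ ≤ x → K ≤ f x) (hmean : 0 ≤ radialMean (N - 1) f ρ) (hs : ρ ≤ s) :
    radialPotential N f ρ + K * (s - ρ) ^ 2 / (2 * N) ≤ radialPotential N f s := by
  refine le_of_hasDerivAt_le (f := fun s => radialPotential N f ρ + K * (s - ρ) ^ 2 / (2 * N))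
    (f' := fun s => K * (s - ρ) / N) (fun x => ?_) (hasDerivAt_radialPotential hf)
    (fun x hx => mul_radialMean_ge hN hf hρ hK hfK hmean hx) (by simp) hs
  refine ((((((hasDerivAt_id x).sub_const ρ).pow 2).const_mul K).div_const _).const_add
    _).congr_deriv ?_
  simp
  field_simp

theorem monotoneOn_radialPotential (hN : 0 < N) (hf : Continuous f) (hf0 : ∀ s, 0 ≤ s → 0 ≤ f s) :
    MonotoneOn (radialPotential N f) (Set.Ici 0) := fun ρ hρ s _ hs => by
  have hmean : 0 ≤ radialMean (N - 1) f ρ := radialMean_nonneg hf fun x hx =>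
    hf0 x (Set.uIcc_of_le (Set.mem_Ici.1 hρ) ▸ hx).1
  simpa using radialPotential_ge hN hf hρ le_rfl (fun x hx => hf0 x (le_trans hρ hx)) hmean hs

theorem eventually_radialMean_nonneg (hf : Continuous f) (hρ : 0 ≤ ρ) (hK : 0 < K)
    (hfK : ∀ x, ρ ≤ x → K ≤ f x) : ∀ᶠ s in atTop, 0 ≤ radialMean k f s := by
  have hlim : Tendsto (fun s => ρ ^ (k + 1) * radialMean k f ρ +
      K * (s ^ (k + 1) - ρ ^ (k + 1)) / (k + 1)) atTop atTop :=
    tendsto_atTop_add_const_left _ _ <| Tendsto.atTop_div_const (by positivity) <|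
      (tendsto_atTop_add_const_right _ _ (tendsto_pow_atTop k.succ_ne_zero)).const_mul_atTop hK
  filter_upwards [hlim.eventually_ge_atTop 0, eventually_ge_atTop ρ, eventually_gt_atTop 0]
    with s hs hρs hs0
  exact nonneg_of_mul_nonneg_right (hs.trans (pow_mul_radialMean_ge hf hρ hfK hρs))
    (pow_pos hs0 _)

/-- Quadratic self-improvement over every step forces blow-up in finite time. -/
theorem not_forall_mul_sq_mul_pow_le {h : ℝ → ℝ} {a c : ℝ} {n : ℕ} (hn : n ≠ 0)
    (hh : Continuous h) (ha : 0 < h a) (hc : 0 < c) :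
    ¬ ∀ x, a ≤ x → ∀ d, 0 ≤ d → c * h x ^ 2 * d ^ n ≤ h (x + d) := by
  intro hgrow
  -- Maximize `(b - x) ^ n * h x` on a long `[a, b]` and step from the maximum halfway to `b`.
  obtain ⟨D, hDpow, hD⟩ := (((tendsto_pow_atTop hn).eventually_gt_atTop (4 ^ n / (c * h a))).and
    (eventually_ge_atTop (0 : ℝ))).exists
  obtain ⟨b, rfl⟩ : ∃ b, D = b - a := ⟨a + D, by ring⟩
  have hab : a ≤ b := sub_nonneg.1 hD
  obtain ⟨x, hx, hmax⟩ := isCompact_Icc.exists_isMaxOn (Set.nonempty_Icc.2 hab)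
    (f := fun x => (b - x) ^ n * h x) (by fun_prop)
  set φ : ℝ := (b - x) ^ n * h x with hφdef
  have hφa : (b - a) ^ n * h a ≤ φ := hmax (Set.left_mem_Icc.2 hab)
  have hlt : 4 ^ n < c * φ :=
    calc (4 : ℝ) ^ n < (b - a) ^ n * (c * h a) := (div_lt_iff₀ (by positivity)).1 hDpow
      _ = c * ((b - a) ^ n * h a) := by ring
      _ ≤ c * φ := by gcongr
  have hφ : 0 < φ := pos_of_mul_pos_right ((by positivity : (0 : ℝ) < 4 ^ n).trans hlt) hc.le
  obtain ⟨d, rfl⟩ : ∃ d, x = b - 2 * d := ⟨(b - x) / 2, by ring⟩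
  have hd : 0 ≤ d := by linarith [hx.2]
  have hmid : d ^ n * h (b - 2 * d + d) ≤ φ := by
    have hmem : b - d ∈ Set.Icc a b := ⟨by linarith [hx.1], by linarith⟩
    calc d ^ n * h (b - 2 * d + d) = (b - (b - d)) ^ n * h (b - d) := by ring_nf
      _ ≤ φ := hmax hmem
  have hsq : c * φ ^ 2 ≤ 4 ^ n * φ :=
    calc c * φ ^ 2 = 4 ^ n * (d ^ n * (c * h (b - 2 * d) ^ 2 * d ^ n)) := by
          rw [hφdef, sub_sub_cancel, mul_pow 2 d, show (4 : ℝ) = 2 ^ 2 by norm_num, pow_right_comm]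
          ring
      _ ≤ 4 ^ n * (d ^ n * h (b - 2 * d + d)) := by gcongr; exact hgrow _ hx.1 d hd
      _ ≤ 4 ^ n * φ := by gcongr
  nlinarith

end Growth

section Sign

variable {N : ℕ} {β σ c : ℝ} {u : ℝ → ℝ}

theorem monotoneOn_integralLaplacian (hN : 0 < N) (hu : Continuous u) :
    MonotoneOn (integralLaplacian N β u) (Set.Ici 0) :=
  (monotoneOn_radialPotential hN hu.rexp fun _ _ => (Real.exp_pos _).le).const_add β

theorem le_integralLaplacian (hu : Continuous u) (r : ℝ) : β ≤ integralLaplacian N β u r :=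
  le_add_of_nonneg_right (radialPotential_nonneg hu.rexp fun _ _ => (Real.exp_pos _).le)

/-- Integrating `e ^ u` over the first half of a step makes `Δu` large, integrating `Δu` over the
second half makes `u` large. -/
theorem IsIntegralSolution.add_exp_mul_pow_le (hN : 0 < N) (h : IsIntegralSolution N β u) {ρ d : ℝ}
    (hρ : 0 ≤ ρ) (hv : 0 ≤ integralLaplacian N β u ρ)
    (hmean : 0 ≤ radialMean (N - 1) (integralLaplacian N β u) ρ) (hd : 0 ≤ d) :
    u ρ + Real.exp (u ρ) * d ^ 4 / (64 * N ^ 2) ≤ u (ρ + d) := by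
  set v : ℝ → ℝ := integralLaplacian N β u
  have hvc : Continuous v := continuous_integralLaplacian h.continuous
  have huv : radialPotential N v = u := h.isFixedPt
  have hvmono := monotoneOn_integralLaplacian (β := β) hN h.continuous
  have hv0 : ∀ x, ρ ≤ x → 0 ≤ v x := fun x hx => hv.trans (hvmono hρ (hρ.trans hx) hx)
  have hu : ∀ x, ρ ≤ x → u ρ ≤ u x := fun x hx => by
    simpa [huv] using radialPotential_ge hN hvc hρ le_rfl hv0 hmean hx
  set m : ℝ := ρ + d / 2 with hm
  have hρm : ρ ≤ m := by linarith
  have hvm : Real.exp (u ρ) * d ^ 2 / (8 * N) ≤ v m := by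
    have hexp := radialPotential_ge hN h.continuous.rexp hρ (Real.exp_pos _).le
      (fun x hx => Real.exp_le_exp.2 (hu x hx))
      (radialMean_nonneg h.continuous.rexp fun _ _ => (Real.exp_pos _).le) hρm
    have hv : v ρ + Real.exp (u ρ) * (m - ρ) ^ 2 / (2 * N) ≤ v m := by
      simp only [v, integralLaplacian] at hexp ⊢
      linarith
    refine le_trans (le_of_eq ?_) ((le_add_of_nonneg_left (hv0 ρ le_rfl)).trans hv)
    rw [hm]
    ring
  have hum := radialPotential_ge hN hvc (hρ.trans hρm) (by positivity)
    (fun x hx => hvm.trans (hvmono (hρ.trans hρm) (hρ.trans (hρm.trans hx)) hx))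
    (radialMean_nonneg_of_le hvc hρ hv0 hmean hρm) (by linarith : m ≤ ρ + d)
  rw [huv] at hum
  refine le_trans (add_le_add (hu m hρm) (le_of_eq ?_)) hum
  rw [hm]
  field_simp
  ring

theorem IsIntegralSolution.integralLaplacian_nonpos (hN : 0 < N) (h : IsIntegralSolution N β u)
    (r : ℝ) : integralLaplacian N β u r ≤ 0 := by
  rw [← apply_abs_of_even (even_integralLaplacian h.even)]
  set v : ℝ → ℝ := integralLaplacian N β u
  have hvc : Continuous v := continuous_integralLaplacian h.continuous
  by_contra! hpos
  have hv : ∀ x, |r| ≤ x → v |r| ≤ v x := fun x hx =>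
    monotoneOn_integralLaplacian hN h.continuous (abs_nonneg r) ((abs_nonneg r).trans hx) hx
  obtain ⟨a, hmean, hra⟩ := ((eventually_radialMean_nonneg (k := N - 1) hvc (abs_nonneg r) hpos
    hv).and (eventually_ge_atTop |r|)).exists
  have ha : 0 ≤ a := (abs_nonneg r).trans hra
  have hv0 : ∀ x, a ≤ x → 0 ≤ v x := fun x hx => hpos.le.trans (hv x (hra.trans hx))
  refine not_forall_mul_sq_mul_pow_le four_ne_zero h.continuous.rexp (Real.exp_pos (u a))
    (c := 1 / (64 * (N : ℝ) ^ 2)) (by positivity) fun x hx d hd => ?_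
  have hstep := h.add_exp_mul_pow_le hN (ha.trans hx) (hv0 x hx)
    (radialMean_nonneg_of_le hvc ha hv0 hmean hx) hd
  calc 1 / (64 * (N : ℝ) ^ 2) * Real.exp (u x) ^ 2 * d ^ 4
      = Real.exp (u x) * (Real.exp (u x) * d ^ 4 / (64 * N ^ 2)) := by ring
    _ ≤ Real.exp (u x) * Real.exp (Real.exp (u x) * d ^ 4 / (64 * N ^ 2)) := by
        gcongr
        linarith [Real.add_one_le_exp (Real.exp (u x) * d ^ 4 / (64 * N ^ 2))]
    _ ≤ Real.exp (u (x + d)) := by rwa [← Real.exp_add, Real.exp_le_exp]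

theorem picardMap_le_of_integralLaplacian_le (hN : 0 < N) (hu : Continuous u)
    (hc : ∀ s, integralLaplacian N β u s ≤ c) (r : ℝ) :
    picardMap N β u r ≤ c * r ^ 2 / (2 * N) :=
  (radialPotential_mono (by fun_prop) continuous_const fun s _ => hc s).trans_eq
    (radialPotential_const hN c r)

theorem le_picardMap (hN : 0 < N) (hu : Continuous u) (r : ℝ) :
    β * r ^ 2 / (2 * N) ≤ picardMap N β u r :=
  (radialPotential_const hN β r).symm.trans_le
    (radialPotential_mono continuous_const (by fun_prop) fun s _ => le_integralLaplacian hu s)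

theorem IsIntegralSolution.le_of_integralLaplacian_le (hN : 0 < N) (h : IsIntegralSolution N β u)
    (hc : ∀ s, integralLaplacian N β u s ≤ c) (r : ℝ) : u r ≤ c * r ^ 2 / (2 * N) :=
  (congrFun h.isFixedPt r).symm.trans_le
    (picardMap_le_of_integralLaplacian_le hN h.continuous hc r)

theorem IsIntegralSolution.nonpos (hN : 0 < N) (h : IsIntegralSolution N β u) (r : ℝ) :
    u r ≤ 0 := by
  simpa using h.le_of_integralLaplacian_le hN (h.integralLaplacian_nonpos hN) r

theorem IsIntegralSolution.nonpos_initial (hN : 0 < N) (h : IsIntegralSolution N β u) : β ≤ 0 :=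
  (integralLaplacian_apply_zero N β u).symm.trans_le (h.integralLaplacian_nonpos hN 0)

theorem IsIntegralSolution.exists_tendsto_integralLaplacian (hN : 0 < N)
    (h : IsIntegralSolution N β u) :
    ∃ σ ≤ 0, Tendsto (integralLaplacian N β u) atTop (𝓝 σ) := by
  have hmono : Monotone fun r => integralLaplacian N β u (max r 0) := fun r s hrs =>
    monotoneOn_integralLaplacian hN h.continuous (le_max_right r 0) (le_max_right s 0)
      (max_le_max_right 0 hrs)
  have hbdd : BddAbove (Set.range fun r => integralLaplacian N β u (max r 0)) :=
    ⟨0, Set.forall_mem_range.2 fun _ => h.integralLaplacian_nonpos hN _⟩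
  refine ⟨_, ciSup_le fun r => h.integralLaplacian_nonpos hN (max r 0),
    (tendsto_atTop_ciSup hmono hbdd).congr' ?_⟩
  filter_upwards [eventually_ge_atTop 0] with r hr
  rw [max_eq_left hr]

theorem IsIntegralSolution.integralLaplacian_le_of_tendsto (hN : 0 < N)
    (h : IsIntegralSolution N β u) (hσ : Tendsto (integralLaplacian N β u) atTop (𝓝 σ)) (r : ℝ) :
    integralLaplacian N β u r ≤ σ := by
  rw [← apply_abs_of_even (even_integralLaplacian h.even)]
  refine ge_of_tendsto hσ ?_
  filter_upwards [eventually_ge_atTop |r|] with s hs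
  exact monotoneOn_integralLaplacian hN h.continuous (abs_nonneg r) ((abs_nonneg r).trans hs) hs

end Sign

/-! ### Comparison in the initial value -/

section Comparison

variable {N : ℕ} {β₁ β₂ r : ℝ} {u₁ u₂ : ℝ → ℝ}

theorem pos_of_forall_Icc_nonneg_imp_pos {z : ℝ → ℝ} (hz : Continuous z) (h0 : 0 ≤ z 0)
    (h : ∀ r, 0 ≤ r → (∀ s ∈ Set.Icc 0 r, 0 ≤ z s) → 0 < z r) (hr : 0 ≤ r) : 0 < z r := by
  by_contra! hneg
  have hroot : ∀ s, 0 ≤ s → z s ≤ 0 → ∃ x ∈ Set.Icc 0 s, z x = 0 := fun s hs hzs =>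
    intermediate_value_Icc' hs hz.continuousOn ⟨hzs, h0⟩
  obtain ⟨a, ⟨ha, hza⟩, hleast⟩ := (isCompact_Icc.inter_right
    (isClosed_eq hz continuous_const)).exists_isLeast (hroot r hr hneg)
  refine (h a ha.1 fun s hs => ?_).ne' hza
  by_contra! hzs
  obtain ⟨x, hx, hzx⟩ := hroot s hs.1 hzs.le
  have hax : a ≤ x := hleast ⟨⟨hx.1, hx.2.trans (hs.2.trans ha.2)⟩, hzx⟩
  rw [le_antisymm hs.2 (hax.trans hx.2), hza] at hzs
  exact lt_irrefl _ hzs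

theorem integralLaplacian_sub_ge (hu₁ : Continuous u₁) (hu₂ : Continuous u₂)
    (h : ∀ s ∈ Set.uIcc 0 r, u₁ s ≤ u₂ s) :
    β₂ - β₁ ≤ integralLaplacian N β₂ u₂ r - integralLaplacian N β₁ u₁ r := by
  have := radialPotential_mono (N := N) hu₁.rexp hu₂.rexp fun s hs => Real.exp_le_exp.2 (h s hs)
  simp only [integralLaplacian]
  linarith

theorem IsIntegralSolution.le_of_forall_integralLaplacian_le (h₁ : IsIntegralSolution N β₁ u₁)
    (h₂ : IsIntegralSolution N β₂ u₂)
    (h : ∀ s ∈ Set.uIcc 0 r, integralLaplacian N β₁ u₁ s ≤ integralLaplacian N β₂ u₂ s) :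
    u₁ r ≤ u₂ r := by
  rw [← congrFun h₁.isFixedPt r, ← congrFun h₂.isFixedPt r]
  exact radialPotential_mono (continuous_integralLaplacian h₁.continuous)
    (continuous_integralLaplacian h₂.continuous) h

theorem IsIntegralSolution.integralLaplacian_lt (h₁ : IsIntegralSolution N β₁ u₁)
    (h₂ : IsIntegralSolution N β₂ u₂) (hβ : β₁ < β₂) (r : ℝ) :
    integralLaplacian N β₁ u₁ r < integralLaplacian N β₂ u₂ r := by
  rw [← apply_abs_of_even (even_integralLaplacian h₁.even) r,
    ← apply_abs_of_even (even_integralLaplacian h₂.even) r, ← sub_pos]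
  have hu₁ := h₁.continuous
  have hu₂ := h₂.continuous
  refine pos_of_forall_Icc_nonneg_imp_pos
    (z := fun r => integralLaplacian N β₂ u₂ r - integralLaplacian N β₁ u₁ r) (by fun_prop)
    (by simpa only [integralLaplacian_apply_zero, sub_nonneg] using hβ.le) (fun r hr hle => ?_)
    (abs_nonneg r)
  refine (sub_pos.2 hβ).trans_le (integralLaplacian_sub_ge hu₁ hu₂ fun s hs => ?_)
  refine h₁.le_of_forall_integralLaplacian_le h₂ fun x hx => sub_nonneg.1 (hle x ?_)
  rw [← Set.uIcc_of_le hr]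
  exact Set.uIcc_subset_uIcc_left hs hx

theorem IsIntegralSolution.le_of_lt (h₁ : IsIntegralSolution N β₁ u₁)
    (h₂ : IsIntegralSolution N β₂ u₂) (hβ : β₁ < β₂) (r : ℝ) : u₁ r ≤ u₂ r :=
  h₁.le_of_forall_integralLaplacian_le h₂ fun s _ => (h₁.integralLaplacian_lt h₂ hβ s).le

end Comparison

/-! ### Limits and supersolutions -/

section Limits

variable {N k : ℕ} {f u B : ℝ → ℝ} {F : ℕ → ℝ → ℝ}

theorem abs_radialPotential_le {g : ℝ → ℝ} (hf : Continuous f) (hg : Continuous g)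
    (h : ∀ s, |f s| ≤ g s) (r : ℝ) : |radialPotential N f r| ≤ radialPotential N g r := by
  rw [radialPotential, abs_mul, abs_sq]
  exact mul_le_mul_of_nonneg_left
    (abs_radialMean_le (by fun_prop) (by fun_prop) (abs_radialMean_le hf hg h) r) (sq_nonneg r)

theorem tendsto_radialMean (hF : ∀ n, Continuous (F n)) (hB : Continuous B)
    (hFB : ∀ n s, |F n s| ≤ B s) (hf : ∀ s, Tendsto (fun n => F n s) atTop (𝓝 (f s))) (r : ℝ) :
    Tendsto (fun n => radialMean k (F n) r) atTop (𝓝 (radialMean k f r)) := by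
  refine intervalIntegral.tendsto_integral_filter_of_dominated_convergence
    (fun t => |t ^ k| * B (r * t))
    (Eventually.of_forall fun n => Continuous.aestronglyMeasurable (by fun_prop))
    (Eventually.of_forall fun n => Eventually.of_forall fun t _ => ?_)
    (Continuous.intervalIntegrable (by fun_prop) _ _)
    (Eventually.of_forall fun t _ => (hf _).const_mul _)
  rw [Real.norm_eq_abs, abs_mul]
  exact mul_le_mul_of_nonneg_left (hFB n _) (abs_nonneg _)

theorem tendsto_radialPotential (hF : ∀ n, Continuous (F n)) (hB : Continuous B)
    (hFB : ∀ n s, |F n s| ≤ B s) (hf : ∀ s, Tendsto (fun n => F n s) atTop (𝓝 (f s))) (r : ℝ) :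
    Tendsto (fun n => radialPotential N (F n) r) atTop (𝓝 (radialPotential N f r)) :=
  (tendsto_radialMean (fun n => continuous_radialMean (hF n)) (continuous_radialMean hB)
    (fun n => abs_radialMean_le (hF n) hB (hFB n)) (tendsto_radialMean hF hB hFB hf)
    r).const_mul (r ^ 2)

theorem abs_radialPotential_sub_le (hf : Continuous f) (hB : Continuous B)
    (hfB : ∀ s, |f s| ≤ B s) (x y : ℝ) :
    |radialPotential N f y - radialPotential N f x| ≤
      |∫ s in x..y, |s| * radialMean (N - 1) B s| := by
  rw [← intervalIntegral.integral_eq_sub_of_hasDerivAt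
    (fun s _ => hasDerivAt_radialPotential hf s) (Continuous.intervalIntegrable (by fun_prop) _ _),
    ← Real.norm_eq_abs]
  refine intervalIntegral.norm_integral_le_abs_of_norm_le (Eventually.of_forall fun s => ?_)
    (Continuous.intervalIntegrable (by fun_prop) _ _)
  rw [Real.norm_eq_abs, abs_mul]
  exact mul_le_mul_of_nonneg_left (abs_radialMean_le hf hB hfB s) (abs_nonneg s)

/-- Potentials of a dominated sequence are locally equicontinuous, whatever their densities do. -/
theorem continuous_of_tendsto_radialPotential (hF : ∀ n, Continuous (F n)) (hB : Continuous B)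
    (hFB : ∀ n s, |F n s| ≤ B s)
    (hu : ∀ r, Tendsto (fun n => radialPotential N (F n) r) atTop (𝓝 (u r))) : Continuous u := by
  refine continuous_iff_continuousAt.2 fun x => tendsto_iff_dist_tendsto_zero.2 <|
    squeeze_zero (fun _ => dist_nonneg) (fun y => le_of_tendsto'
      (((hu y).sub (hu x)).abs) fun n => abs_radialPotential_sub_le (hF n) hB (hFB n) x y) ?_
  have hcont : Continuous fun y => |∫ s in x..y, |s| * radialMean (N - 1) B s| :=
    (intervalIntegral.continuous_primitive (fun _ _ =>
      Continuous.intervalIntegrable (by fun_prop) _ _) x).abs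
  simpa using hcont.tendsto x

theorem isIntegralSolution_of_tendsto {β : ℝ} {b : ℕ → ℝ} (hb : Tendsto b atTop (𝓝 β))
    (hF : ∀ n, Continuous (F n)) (hFeven : ∀ n, Function.Even (F n)) (hB : Continuous B)
    (hFB : ∀ n s, |F n s| ≤ B s) (hu : ∀ r, Tendsto (fun n => F n r) atTop (𝓝 (u r)))
    (hFu : ∀ r, Tendsto (fun n => picardMap N (b n) (F n) r) atTop (𝓝 (u r))) :
    IsIntegralSolution N β u := by
  obtain ⟨A, hA⟩ := hb.abs.bddAbove_range
  have hexp : ∀ n s, |Real.exp (F n s)| ≤ Real.exp (B s) := fun n s => by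
    rw [Real.abs_exp, Real.exp_le_exp]
    exact (le_abs_self _).trans (hFB n s)
  have hvB : ∀ n s, |integralLaplacian N (b n) (F n) s| ≤
      A + radialPotential N (fun s => Real.exp (B s)) s := fun n s =>
    (abs_add_le _ _).trans (add_le_add (hA ⟨n, rfl⟩)
      (abs_radialPotential_le (hF n).rexp hB.rexp (hexp n) s))
  have hv : ∀ n, Continuous (integralLaplacian N (b n) (F n)) := fun n =>
    continuous_integralLaplacian (hF n)
  have hvlim : ∀ s, Tendsto (fun n => integralLaplacian N (b n) (F n) s) atTop
      (𝓝 (integralLaplacian N β u s)) := fun s =>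
    hb.add (tendsto_radialPotential (fun n => (hF n).rexp) hB.rexp hexp (fun s => (hu s).rexp) s)
  refine ⟨fun r => tendsto_nhds_unique (hu (-r)) ?_,
    continuous_of_tendsto_radialPotential hv (by fun_prop) hvB hFu, funext fun r => ?_⟩
  · simpa only [hFeven _ r] using hu r
  · exact tendsto_nhds_unique (tendsto_radialPotential hv (by fun_prop) hvB hvlim r) (hFu r)

end Limits

section Supersolutions

variable {N : ℕ} {β β₁ β₂ : ℝ} {u w U : ℝ → ℝ}

theorem picardMap_mono (hβ : β₁ ≤ β₂) (hu : Continuous u) (hw : Continuous w) (h : u ≤ w) :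
    picardMap N β₁ u ≤ picardMap N β₂ w := fun _ =>
  radialPotential_mono (by fun_prop) (by fun_prop) fun _ _ =>
    add_le_add hβ (radialPotential_mono hu.rexp hw.rexp fun s _ => Real.exp_le_exp.2 (h s))

theorem continuous_iterate_picardMap (hU : Continuous U) (n : ℕ) :
    Continuous ((picardMap N β)^[n] U) :=
  Function.Iterate.rec (fun w : ℝ → ℝ => Continuous w) hU (fun _ hw => continuous_picardMap hw) n

theorem even_iterate_picardMap (hU : Function.Even U) (n : ℕ) :
    Function.Even ((picardMap N β)^[n] U) :=
  Function.Iterate.rec (fun w : ℝ → ℝ => Function.Even w) hU (fun _ hw => even_picardMap hw) n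

theorem antitone_iterate_picardMap (hU : Continuous U) (hsuper : picardMap N β U ≤ U) :
    Antitone fun n => (picardMap N β)^[n] U := by
  refine antitone_nat_of_succ_le fun n => ?_
  induction n with
  | zero => exact hsuper
  | succ n ih =>
    simpa only [← Function.iterate_succ_apply'] using picardMap_mono (N := N) (le_refl β)
      (continuous_iterate_picardMap hU (n + 1)) (continuous_iterate_picardMap hU n) ih

theorem le_iterate_picardMap (hN : 0 < N) (hU : Continuous U) (hsuper : picardMap N β U ≤ U)
    (n : ℕ) (r : ℝ) : β * r ^ 2 / (2 * N) ≤ (picardMap N β)^[n] U r := by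
  have hle : (picardMap N β)^[n + 1] U r ≤ (picardMap N β)^[n] U r :=
    antitone_iterate_picardMap hU hsuper n.le_succ r
  rw [Function.iterate_succ_apply'] at hle
  exact (le_picardMap hN (continuous_iterate_picardMap hU n) r).trans hle

theorem exists_isIntegralSolution_of_picardMap_le (hN : 0 < N) (hU : Continuous U)
    (hUeven : Function.Even U) (hsuper : ∀ r, 0 ≤ r → picardMap N β U r ≤ U r) :
    ∃ u, IsIntegralSolution N β u := by
  replace hsuper : picardMap N β U ≤ U := fun r => by
    rw [← apply_abs_of_even (even_picardMap hUeven), ← apply_abs_of_even hUeven]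
    exact hsuper _ (abs_nonneg r)
  have hanti := antitone_iterate_picardMap hU hsuper
  have hlower := le_iterate_picardMap hN hU hsuper
  have hlim : ∀ r, Tendsto (fun n => (picardMap N β)^[n] U r) atTop
      (𝓝 (⨅ n, (picardMap N β)^[n] U r)) := fun r =>
    tendsto_atTop_ciInf (fun _ _ hmn => hanti hmn r)
      ⟨_, Set.forall_mem_range.2 fun n => hlower n r⟩
  refine ⟨_, isIntegralSolution_of_tendsto (B := fun r => max |β * r ^ 2 / (2 * N)| |U r|)
    tendsto_const_nhds (continuous_iterate_picardMap hU) (even_iterate_picardMap hUeven)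
    (by fun_prop) (fun n r => abs_le_max_abs_abs (hlower n r) (hanti n.zero_le r)) hlim
    fun r => ?_⟩
  simpa only [Function.iterate_succ_apply'] using (tendsto_add_atTop_iff_nat 1).2 (hlim r)

theorem IsIntegralSolution.exists_of_le (hN : 0 < N) (h : IsIntegralSolution N β₂ u)
    (hβ : β₁ ≤ β₂) : ∃ w, IsIntegralSolution N β₁ w :=
  exists_isIntegralSolution_of_picardMap_le hN h.continuous h.even fun r _ =>
    (picardMap_mono hβ h.continuous h.continuous le_rfl r).trans_eq (congrFun h.isFixedPt r)

theorem exists_isIntegralSolution_of_isLUB (hN : 0 < N)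
    (hβ : IsLUB {β | ∃ u, IsIntegralSolution N β u} β) : ∃ u, IsIntegralSolution N β u := by
  by_contra hnot
  obtain ⟨b, hbmono, -, hblim, hb⟩ := hβ.exists_seq_strictMono_tendsto_of_notMem hnot hβ.nonempty
  choose w hw using hb
  have hwmono : ∀ m n, m ≤ n → ∀ r, w m r ≤ w n r := fun m n hmn r => by
    rcases hmn.eq_or_lt with rfl | hlt
    exacts [le_rfl, (hw m).le_of_lt (hw n) (hbmono hlt) r]
  have hwnonpos : ∀ n r, w n r ≤ 0 := fun n => (hw n).nonpos hN
  have hlim : ∀ r, Tendsto (fun n => w n r) atTop (𝓝 (⨆ n, w n r)) := fun r =>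
    tendsto_atTop_ciSup (fun m n hmn => hwmono m n hmn r)
      ⟨0, Set.forall_mem_range.2 fun n => hwnonpos n r⟩
  refine hnot ⟨_, isIntegralSolution_of_tendsto hblim (fun n => (hw n).continuous)
    (fun n => (hw n).even) (hw 0).continuous.abs (fun n r => ?_) hlim fun r => ?_⟩
  · exact abs_le_abs_of_nonpos (hwnonpos n r) (hwmono 0 n n.zero_le r)
  · simpa only [(hw _).isFixedPt.eq] using hlim r

end Supersolutions

/-! ### Dimension at least three -/

section Gaussian

variable {N : ℕ} {f : ℝ → ℝ} {r : ℝ}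

theorem radialPotential_le_integral (hN : 3 ≤ N) (hf : Continuous f)
    (hf0 : ∀ s ∈ Set.uIcc 0 r, 0 ≤ f s) : radialPotential N f r ≤ ∫ s in (0 : ℝ)..r, s * f s := by
  have hN' : (3 : ℝ) ≤ N := by exact_mod_cast hN
  rw [← radialPotential_add_sq_mul_radialMean (N := N) (by lia) hf r]
  nlinarith [radialPotential_nonneg (N := N) hf hf0,
    mul_nonneg (sq_nonneg r) (radialMean_nonneg (k := N - 1) hf hf0)]

theorem integral_mul_exp_neg_mul_sq {a : ℝ} (ha : a ≠ 0) (r : ℝ) :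
    ∫ s in (0 : ℝ)..r, s * Real.exp (-(a * s ^ 2)) = (1 - Real.exp (-(a * r ^ 2))) / (2 * a) := by
  have hderiv : ∀ s, HasDerivAt (fun s => -Real.exp (-(a * s ^ 2)) / (2 * a))
      (s * Real.exp (-(a * s ^ 2))) s := fun s => by
    refine ((((hasDerivAt_pow 2 s).const_mul a).neg.exp.neg).div_const _).congr_deriv ?_
    simp only [Nat.cast_ofNat, Pi.neg_apply]
    field_simp
    norm_num
  rw [intervalIntegral.integral_eq_sub_of_hasDerivAt (fun s _ => hderiv s)
    (Continuous.intervalIntegrable (by fun_prop) _ _), zero_pow two_ne_zero, mul_zero, neg_zero,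
    Real.exp_zero]
  ring

theorem radialPotential_exp_neg_mul_sq_le (hN : 3 ≤ N) {a : ℝ} (ha : 0 < a) (r : ℝ) :
    radialPotential N (fun s => Real.exp (-(a * s ^ 2))) r ≤ 1 / (2 * a) := by
  refine (radialPotential_le_integral hN (by fun_prop) fun _ _ => (Real.exp_pos _).le).trans ?_
  rw [integral_mul_exp_neg_mul_sq ha.ne']
  gcongr
  exact sub_le_self _ (Real.exp_pos _).le

theorem exists_isIntegralSolution (hN : 3 ≤ N) : ∃ β u, IsIntegralSolution N β u := by
  have hN0 : 0 < N := by lia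
  -- With `u = -r² / (2N)` and `β = -(1 + N)`, the Gaussian bound gives `Δu ≤ -1`.
  refine ⟨-(1 + N), exists_isIntegralSolution_of_picardMap_le hN0
    (U := fun s => -(1 / (2 * N) * s ^ 2)) (by fun_prop) (fun s => by simp only [neg_sq]) fun r _ =>
      (picardMap_le_of_integralLaplacian_le hN0 (by fun_prop) (c := -1) (fun s => ?_)
        r).trans_eq (by ring)⟩
  have hP := radialPotential_exp_neg_mul_sq_le hN (a := 1 / (2 * (N : ℝ))) (by positivity) s
  rw [show 1 / (2 * (1 / (2 * (N : ℝ)))) = N by field_simp] at hP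
  rw [integralLaplacian]
  linarith

end Gaussian

section Perturbation

variable {N : ℕ} {β ε σ r : ℝ} {f k u Z : ℝ → ℝ}

theorem radialPotential_le_of_monotoneOn (hN : 0 < N) (hf : Continuous f)
    (hmono : MonotoneOn f (Set.Ici 0)) (hr : 0 ≤ r) :
    radialPotential N f r ≤ f r * r ^ 2 / (2 * N) := by
  rw [← radialPotential_const hN]
  refine radialPotential_mono hf continuous_const fun s hs => ?_
  rw [Set.uIcc_of_le hr] at hs
  exact hmono hs.1 hr hs.2

/-- `exp (P k)` is a supersolution of the linear problem `Δ φ = k φ`, `φ(0) = 1`. -/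
theorem one_add_radialPotential_exp_mul_le (hN : 0 < N) (hk : Continuous k)
    (hk0 : ∀ s, 0 ≤ s → 0 ≤ k s) (hr : 0 ≤ r) :
    1 + radialPotential N (fun s => Real.exp (radialPotential N k s) * k s) r ≤
      Real.exp (radialPotential N k r) := by
  set φ : ℝ → ℝ := fun s => Real.exp (radialPotential N k s)
  have hφk : Continuous fun s => φ s * k s := by fun_prop
  refine le_of_hasDerivAt_le (fun x => (hasDerivAt_radialPotential hφk x).const_add 1)
    (fun x => (hasDerivAt_radialPotential hk x).exp) (fun x hx => ?_)
    (by simp [radialPotential_apply_zero]) hr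
  rw [mul_left_comm, mul_comm (Real.exp _), ← radialMean_mul_const]
  refine mul_le_mul_of_nonneg_left (radialMean_mono hφk (by fun_prop) fun s hs => ?_) hx
  rw [Set.uIcc_of_le hx] at hs
  rw [mul_comm]
  exact mul_le_mul_of_nonneg_left
    (Real.exp_le_exp.2 (monotoneOn_radialPotential hN hk hk0 hs.1 hx hs.2)) (hk0 s hs.1)

theorem exp_add_sub_exp_le (x w : ℝ) : Real.exp (x + w) - Real.exp x ≤ w * Real.exp (x + w) := by
  have hx : Real.exp x = Real.exp (x + w) * Real.exp (-w) := by
    rw [← Real.exp_add, add_neg_cancel_right]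
  nlinarith [Real.add_one_le_exp (-w), Real.exp_pos (x + w)]

theorem IsIntegralSolution.exists_add (hN : 0 < N) (h : IsIntegralSolution N β u)
    (hZ : Continuous Z) (hZeven : Function.Even Z)
    (hsuper : ∀ r, 0 ≤ r → ε + radialPotential N
      (fun s => Real.exp (u s + radialPotential N Z s) - Real.exp (u s)) r ≤ Z r) :
    ∃ w, IsIntegralSolution N (β + ε) w := by
  have hu := h.continuous
  set U : ℝ → ℝ := fun s => u s + radialPotential N Z s
  have hU : Continuous U := by fun_prop
  have hv : ∀ r, 0 ≤ r → integralLaplacian N (β + ε) U r ≤ integralLaplacian N β u r + Z r :=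
    fun r hr => by
      have hadd := radialPotential_add (N := N) hu.rexp
        (g := fun s => Real.exp (U s) - Real.exp (u s)) (by fun_prop) r
      simp only [add_sub_cancel] at hadd
      simp only [integralLaplacian, hadd]
      linarith [hsuper r hr]
  refine exists_isIntegralSolution_of_picardMap_le hN hU (h.even.add (even_radialPotential hZeven))
    fun r hr => ?_
  calc picardMap N (β + ε) U r ≤ radialPotential N (fun s => integralLaplacian N β u s + Z s) r :=
        radialPotential_mono (by fun_prop) (by fun_prop) fun s hs =>
          hv s (Set.uIcc_of_le hr ▸ hs).1
    _ = picardMap N β u r + radialPotential N Z r := radialPotential_add (by fun_prop) hZ r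
    _ = U r := by rw [h.isFixedPt.eq]

theorem IsIntegralSolution.exists_add_of_mul_exp_le (hN : 0 < N) (h : IsIntegralSolution N β u)
    (hk : Continuous k) (hkeven : Function.Even k) (hk0 : ∀ s, 0 ≤ s → 0 ≤ k s) (hε : 0 ≤ ε)
    (hZ : Z = fun s => Real.exp (radialPotential N k s) * ε)
    (hle : ∀ s, 0 ≤ s → radialPotential N Z s * Real.exp (u s + radialPotential N Z s) ≤
      Z s * k s) :
    ∃ w, IsIntegralSolution N (β + ε) w := by
  have hu := h.continuous
  have hZc : Continuous Z := by rw [hZ]; fun_prop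
  refine h.exists_add hN hZc (fun s => by simp only [hZ, even_radialPotential hkeven s])
    fun r hr => ?_
  calc ε + radialPotential N (fun s => Real.exp (u s + radialPotential N Z s) - Real.exp (u s)) r
      ≤ ε + radialPotential N (fun s => Real.exp (radialPotential N k s) * k s * ε) r := by
        gcongr
        refine radialPotential_mono (by fun_prop) (by fun_prop) fun s hs => ?_
        refine ((exp_add_sub_exp_le _ _).trans (hle s (Set.uIcc_of_le hr ▸ hs).1)).trans_eq ?_
        rw [hZ, mul_right_comm]
    _ = (1 + radialPotential N (fun s => Real.exp (radialPotential N k s) * k s) r) * ε := by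
        rw [radialPotential_mul_const, add_mul, one_mul]
    _ ≤ Real.exp (radialPotential N k r) * ε :=
        mul_le_mul_of_nonneg_right (one_add_radialPotential_exp_mul_le hN hk hk0 hr) hε
    _ = Z r := by rw [hZ]

theorem radialPotential_exp_mul_const_le (hN : 0 < N) (hk : Continuous k)
    (hk0 : ∀ s, 0 ≤ s → 0 ≤ k s) (hε : 0 ≤ ε) (hr : 0 ≤ r) :
    radialPotential N (fun s => Real.exp (radialPotential N k s) * ε) r ≤
      Real.exp (radialPotential N k r) * ε * r ^ 2 / (2 * N) :=
  radialPotential_le_of_monotoneOn hN (by fun_prop)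
    (fun _ hx _ hy hxy => mul_le_mul_of_nonneg_right
      (Real.exp_le_exp.2 (monotoneOn_radialPotential hN hk hk0 hx hy hxy)) hε) hr

theorem sq_mul_exp_neg_le {b : ℝ} (hb : 0 < b) (s : ℝ) :
    s ^ 2 * Real.exp (-(2 * b * s ^ 2)) ≤ Real.exp (-(b * s ^ 2)) / b := by
  have hsplit : Real.exp (-(b * s ^ 2)) =
      Real.exp (b * s ^ 2) * Real.exp (-(2 * b * s ^ 2)) := by
    rw [← Real.exp_add]
    ring_nf
  have hsq : b * s ^ 2 ≤ Real.exp (b * s ^ 2) := by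
    linarith [Real.add_one_le_exp (b * s ^ 2)]
  rw [hsplit, le_div_iff₀' hb, ← mul_assoc]
  gcongr

theorem mul_exp_le_of_le_sq_of_le_neg_sq (hN : 0 < N) {b s w x z : ℝ} (hb : 0 < b) (hz : 0 ≤ z)
    (hw : w ≤ z * s ^ 2 / (2 * N)) (hx : x ≤ -(2 * b * s ^ 2)) :
    w * Real.exp x ≤ z * (Real.exp (-(b * s ^ 2)) * (1 / (2 * N * b))) :=
  calc w * Real.exp x ≤ z * s ^ 2 / (2 * N) * Real.exp (-(2 * b * s ^ 2)) := by gcongr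
    _ = z / (2 * N) * (s ^ 2 * Real.exp (-(2 * b * s ^ 2))) := by ring
    _ ≤ z / (2 * N) * (Real.exp (-(b * s ^ 2)) / b) := by
        gcongr ?_ * ?_
        exact sq_mul_exp_neg_le hb s
    _ = z * (Real.exp (-(b * s ^ 2)) * (1 / (2 * N * b))) := by field_simp

theorem IsIntegralSolution.exists_gt (hN : 3 ≤ N) (h : IsIntegralSolution N β u) (hσ : σ < 0)
    (hv : ∀ r, integralLaplacian N β u r ≤ σ) : ∃ β' > β, ∃ w, IsIntegralSolution N β' w := by
  have hN0 : 0 < N := by lia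
  obtain ⟨b, hb, rfl⟩ : ∃ b, 0 < b ∧ σ = -(8 * N * b) :=
    ⟨-σ / (8 * N), by have := neg_pos.2 hσ; positivity, by field_simp⟩
  set K : ℝ := 1 / (2 * b) * (1 / (2 * N * b))
  set k : ℝ → ℝ := fun s => Real.exp (-(b * s ^ 2)) * (1 / (2 * N * b)) with hkdef
  set ε : ℝ := Real.exp (-K) * (4 * N * b) with hε
  set Z : ℝ → ℝ := fun s => Real.exp (radialPotential N k s) * ε with hZ
  have hk : Continuous k := by fun_prop
  have hk0 : ∀ s, 0 ≤ s → 0 ≤ k s := fun s _ => by positivity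
  have hε0 : 0 < ε := by positivity
  -- The choice of `ε` gives `Z ≤ -σ / 2`, hence `u + P Z ≤ σ s² / (4N) = -2 b s²`.
  have hZle : ∀ s, Z s ≤ 4 * N * b := fun s => by
    have hPk : radialPotential N k s ≤ K := by
      rw [hkdef, radialPotential_mul_const]
      exact mul_le_mul_of_nonneg_right (radialPotential_exp_neg_mul_sq_le hN hb s) (by positivity)
    calc Z s ≤ Real.exp K * ε := mul_le_mul_of_nonneg_right (Real.exp_le_exp.2 hPk) hε0.le
      _ = 4 * N * b := by rw [hε, ← mul_assoc, ← Real.exp_add, add_neg_cancel, Real.exp_zero,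
        one_mul]
  refine ⟨β + ε, lt_add_of_pos_right β hε0, h.exists_add_of_mul_exp_le hN0 hk
    (fun s => by simp only [hkdef, neg_sq]) hk0 hε0.le hZ fun s hs => ?_⟩
  have hPZ := radialPotential_exp_mul_const_le hN0 hk hk0 hε0.le hs
  refine mul_exp_le_of_le_sq_of_le_neg_sq hN0 hb (mul_nonneg (Real.exp_pos _).le hε0.le) hPZ ?_
  calc u s + radialPotential N Z s
      ≤ -(8 * N * b) * s ^ 2 / (2 * N) + 4 * N * b * s ^ 2 / (2 * N) := by
        refine add_le_add (h.le_of_integralLaplacian_le hN0 hv s) (hPZ.trans ?_)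
        exact div_le_div_of_nonneg_right
          (mul_le_mul_of_nonneg_right (hZle s) (sq_nonneg s)) (by positivity)
    _ = -(2 * b * s ^ 2) := by
        field_simp
        ring

end Perturbation

/-! ### The threshold -/

section Threshold

variable {N : ℕ} {β σ : ℝ} {u : ℝ → ℝ}

theorem isLUB_betaZero (hN : 3 ≤ N) : IsLUB {β | ∃ u, IsIntegralSolution N β u} (betaZero N) := by
  have hN0 : 0 < N := by lia
  simp only [betaZero, isEntireRadialSolution_iff hN0]
  exact isLUB_csSup (exists_isIntegralSolution hN) ⟨0, fun _ ⟨_, h⟩ => h.nonpos_initial hN0⟩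

theorem exists_isIntegralSolution_betaZero (hN : 3 ≤ N) :
    ∃ u, IsIntegralSolution N (betaZero N) u :=
  exists_isIntegralSolution_of_isLUB (by lia) (isLUB_betaZero hN)

theorem exists_isIntegralSolution_iff_le_betaZero (hN : 3 ≤ N) :
    (∃ u, IsIntegralSolution N β u) ↔ β ≤ betaZero N := by
  obtain ⟨u, hu⟩ := exists_isIntegralSolution_betaZero hN
  exact ⟨fun h => (isLUB_betaZero hN).1 h, hu.exists_of_le (by lia)⟩

theorem IsIntegralSolution.eq_betaZero_of_tendsto_zero (hN : 3 ≤ N) (h : IsIntegralSolution N β u)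
    (h0 : Tendsto (integralLaplacian N β u) atTop (𝓝 0)) : β = betaZero N := by
  have hN0 : 0 < N := by lia
  obtain ⟨u₀, hu₀⟩ := exists_isIntegralSolution_betaZero hN
  refine le_antisymm ((isLUB_betaZero hN).1 ⟨u, h⟩) (not_lt.1 fun hlt => ?_)
  have hgap : ∀ r, integralLaplacian N β u r ≤ β - betaZero N := fun r => by
    have := integralLaplacian_sub_ge (N := N) (β₁ := β) (β₂ := betaZero N) (r := r) h.continuous
      hu₀.continuous fun s _ => h.le_of_lt hu₀ hlt s
    linarith [hu₀.integralLaplacian_nonpos hN0 r]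
  linarith [le_of_tendsto' h0 hgap]

theorem IsIntegralSolution.limit_eq_zero_of_betaZero (hN : 3 ≤ N)
    (h : IsIntegralSolution N (betaZero N) u) (hσ0 : σ ≤ 0)
    (hσ : Tendsto (integralLaplacian N (betaZero N) u) atTop (𝓝 σ)) : σ = 0 := by
  by_contra hne
  obtain ⟨β', hβ', hw⟩ := h.exists_gt hN (lt_of_le_of_ne hσ0 hne)
    (h.integralLaplacian_le_of_tendsto (by lia) hσ)
  exact hβ'.not_ge ((isLUB_betaZero hN).1 hw)

end Threshold

theorem proposition3p1 (N : ℕ) (hN : 3 ≤ N) :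
    (∀ β : ℝ, (∃ u : ℝ → ℝ, IsEntireRadialSolution N β u) ↔ β ≤ betaZero N) ∧
    ∀ β : ℝ, β ≤ betaZero N → ∀ u : ℝ → ℝ, IsEntireRadialSolution N β u →
      ∃ σ : ℝ, Tendsto (radialLaplacian N u) atTop (𝓝 σ) ∧ σ ≤ 0 ∧
        (σ = 0 ↔ β = betaZero N) := by
  have hN0 : 0 < N := by lia
  refine ⟨fun β => ?_, fun β _ u hu => ?_⟩
  · simp only [isEntireRadialSolution_iff hN0, exists_isIntegralSolution_iff_le_betaZero hN]
  · have h : IsIntegralSolution N β u := hu.isIntegralSolution hN0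
    obtain ⟨σ, hσ0, hσ⟩ := h.exists_tendsto_integralLaplacian hN0
    rw [hu.radialLaplacian_eq hN0]
    refine ⟨σ, hσ, hσ0, ?_, ?_⟩
    · rintro rfl
      exact h.eq_betaZero_of_tendsto_zero hN hσ
    · rintro rfl
      exact h.limit_eq_zero_of_betaZero hN hσ0 hσ
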